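/- Let $\mathcal R$ be the class of left rays, i.e. of the sets $(-\infty,a)$ and $(-\infty,a]$ with $a\in\mathbb R$, together with $\varnothing$ and $\mathbb R$. For a Borel probability measure $\nu$ on $\mathbb R$ let $$G(\mathcal R)=\{g\in L^2(\nu): \{g>r\}\in\mathcal R \text{ up to a } \nu\text{-null set, for all } r\in\mathbb R\},$$ and let $\mathrm{proj}_{G(\mathcal R)}$ be the metric projection of $L^2(\nu)$ onto $G(\mathcal R)$. For a Borel probability measure $\mu\ll\nu$ with $d\mu/d\nu\in L^2(\nu)$, the $f$-divergence over rays is $$D_f^{\mathcal R}(\mu\Vert\nu)=\int_{\mathbb R} f\Bigl(\mathrm{proj}_{G(\mathcal R)}\frac{d\mu}{d\nu}\Bigr)\,d\nu .$$ **Theorem (Glivenko–Cantelli theorem for $f$-divergence II).** Let $f:[0,\infty)\to\mathbb R$ be convex with $f(1)=0$ and strictly convex at $1$, i.e. $t f(x)+(1-t)f(y)>0$ for all $x\neq y$ in $[0,\infty)$ and $t\in(0,1)$ with $tx+(1-t)y=1$. Let $\nu$ be a Borel probability measure on $\mathbb R$, let $X_1,X_2,\dots$ be independent random variables with law $\nu$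 on a probability space, and let $\nu_n=\frac1n\sum_{i=1}^n\delta_{X_i}$ be the empirical measures. Then, almost surely, $$D_f^{\mathcal R}(\nu\Vert\nu_n)\longrightarrow 0$$ as $n\to\infty$ through those $n$ for which the divergence is defined, that is, for which $\nu\ll\nu_n$ (such $n$ exist only if $\nu$ is supported by a finite set). If $\nu$ is supported by a finite set, then almost surely $\nu\ll\nu_n$ for all sufficiently large $n$, and $\lim_{n\to\infty}D_f^{\mathcal R}(\nu\Vert\nu_n)=0$. -/

import Mathlib

open MeasureTheory ProbabilityTheory Filter Topology
open scoped ENNReal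

noncomputable section

namespace RayDivergence

/-- The class of (left) rays: all open and closed left rays of the real line, together with the
empty set and the whole line. -/
def rays : Set (Set ℝ) :=
  {A | (∃ a : ℝ, A = Set.Iio a) ∨ (∃ a : ℝ, A = Set.Iic a) ∨ A = ∅ ∨ A = Set.univ}

/-- The cone `G(R)` of all `g` in `L²(ν)` whose superlevel sets `{g > r}` are rays. Elements of
`L²(ν)` are classes of functions modulo `ν`-null sets, so the membership is understood, as every
condition on such a class, up to a `ν`-null set. Equivalently, `g` is nonincreasing off a null
set. -/
def rayCone (ν : Measure ℝ) : Set (Lp ℝ 2 ν) :=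
  {g | ∀ r : ℝ, ∃ A ∈ rays, {x : ℝ | r < g x} =ᵐ[ν] A}

/-- The metric projection onto a set `M`: a point of `M` that is closest to `g`. It is used for
nonempty closed convex subsets of a Hilbert space, where there is exactly one such point. -/
def metricProj {E : Type*} [NormedAddCommGroup E] (M : Set E) (g : E) : E :=
  Classical.epsilon fun p : E => p ∈ M ∧ ∀ h ∈ M, ‖g - p‖ ≤ ‖g - h‖

open Classical in
/-- The Radon--Nikodym derivative `dμ/dν` as an element of `L²(ν)`. It is meant for `μ ≪ ν` with a
square-integrable derivative, and has the default value `0` if the derivative is not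
square-integrable. (For `μ` a probability measure, `ν` supported by a finite set and `μ ≪ ν`, the
derivative is always square-integrable.) -/
def densityL2 (μ ν : Measure ℝ) : Lp ℝ 2 ν :=
  if h : MemLp (fun x => (μ.rnDeriv ν x).toReal) 2 ν then h.toLp _ else 0

/-- The `f`-divergence over rays, `∫ f (proj_{G(R)} (dμ/dν)) dν`, for `μ ≪ ν`. -/
def rayDiv (f : ℝ → ℝ) (μ ν : Measure ℝ) : ℝ :=
  ∫ x, f (metricProj (rayCone ν) (densityL2 μ ν) x) ∂ν

/-- The class `F` of convex functions on `[0, ∞)` that vanish at `1` and are strictly convex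
at `1`. Functions are total in Lean; only the values on `[0, ∞)` are constrained. -/
structure IsDivergenceFunction (f : ℝ → ℝ) : Prop where
  convex : ConvexOn ℝ (Set.Ici 0) f
  map_one : f 1 = 0
  strict_at_one : ∀ x y t : ℝ, 0 ≤ x → 0 ≤ y → x ≠ y → 0 < t → t < 1 →
    t * x + (1 - t) * y = 1 → 0 < t * f x + (1 - t) * f y

/-- The empirical measure `(1/n) ∑ δ_{X i ω}` of the first `n` sample points (`n ≥ 1`). -/
def empiricalMeasure {Ω : Type*} (X : ℕ → Ω → ℝ) (n : ℕ) (ω : Ω) : Measure ℝ :=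
  (n : ℝ≥0∞)⁻¹ • ∑ i ∈ Finset.range n, Measure.dirac (X i ω)

end RayDivergence

end

namespace RayDivergence

/-! Every `ν_n` has finite support, so `ν ≪ ν_n` forces `ν` to be finitely supported; otherwise the
limit is vacuous. Suppose `ν` lives on a finite set of atoms. The strong law at each atom
(`ae_tendsto_empiricalMeasure_real`) makes the density `ν{s} / ν_n{s}` tend to 1 uniformly over the
atoms. The constant 1 lies in the cone, so the projection is also close to 1 in `L²(ν_n)`. The atoms
keep masses bounded away from zero, so this closeness is pointwise
(`measureReal_singleton_mul_sq_proj_le`), and continuity of `f` at 1 with `f 1 = 0` finishes the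
proof (`tendsto_rayDiv_of_tendsto_singleton`). -/

lemma isLowerSet_of_mem_rays {A : Set ℝ} (hA : A ∈ rays) : IsLowerSet A := by
  rcases hA with ⟨a, rfl⟩ | ⟨a, rfl⟩ | rfl | rfl
  · exact isLowerSet_Iio a
  · exact isLowerSet_Iic a
  · exact isLowerSet_empty
  · exact isLowerSet_univ

lemma mem_rays_of_isLowerSet {A : Set ℝ} (hA : IsLowerSet A) : A ∈ rays := by
  rcases A.eq_empty_or_nonempty with h0 | h0
  · exact Or.inr (Or.inr (Or.inl h0))
  by_cases hb : BddAbove A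
  · have hlub := isLUB_csSup h0 hb
    by_cases hm : sSup A ∈ A
    · refine Or.inr (Or.inl ⟨sSup A, Set.Subset.antisymm (fun x hx => hlub.1 hx) ?_⟩)
      exact fun x hx => hA hx hm
    · refine Or.inl ⟨sSup A, Set.Subset.antisymm ?_ ?_⟩
      · exact fun x hx => lt_of_le_of_ne (hlub.1 hx) fun h => hm (h ▸ hx)
      · intro x hx
        obtain ⟨y, hy, hxy⟩ := exists_lt_of_lt_csSup h0 hx
        exact hA hxy.le hy
  · refine Or.inr (Or.inr (Or.inr (Set.eq_univ_of_forall fun x => ?_)))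
    obtain ⟨y, hy, hxy⟩ := not_bddAbove_iff.1 hb x
    exact hA hxy.le hy

/-- The cone of the rays consists of the functions that are nonincreasing off a null set. -/
lemma mem_rayCone_iff {ν : Measure ℝ} {g : Lp ℝ 2 ν} :
    g ∈ rayCone ν ↔ ∃ T : Set ℝ, (∀ᵐ x ∂ν, x ∈ T) ∧ AntitoneOn g T := by
  constructor
  · intro hg
    choose A hA hgA using hg
    -- Only rational levels are used, so that countably many null sets are discarded.
    refine ⟨{x | ∀ q : ℚ, ((q : ℝ) < g x ↔ x ∈ A q)}, ?_, ?_⟩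
    · refine ae_all_iff.2 fun q => ?_
      filter_upwards [hgA q] with x hx
      exact iff_of_eq hx
    · intro x hx y hy hxy
      by_contra! h
      obtain ⟨q, hq1, hq2⟩ := exists_rat_btwn h
      exact hq1.not_gt ((hx q).2 (isLowerSet_of_mem_rays (hA q) hxy ((hy q).1 hq2)))
  · rintro ⟨T, hT, hg⟩ r
    refine ⟨lowerClosure (T ∩ {x | r < g x}), mem_rays_of_isLowerSet (lowerClosure _).lower, ?_⟩
    filter_upwards [hT] with x hx
    refine propext ⟨fun h => subset_lowerClosure ⟨hx, h⟩, fun h => ?_⟩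
    obtain ⟨y, ⟨hyT, hy⟩, hxy⟩ := mem_lowerClosure.1 h
    exact lt_of_lt_of_le hy (hg hx hyT hxy)

lemma convex_rayCone (ν : Measure ℝ) : Convex ℝ (rayCone ν) := by
  intro g hg h hh a b ha hb _
  obtain ⟨T, hT, hgT⟩ := mem_rayCone_iff.1 hg
  obtain ⟨U, hU, hhU⟩ := mem_rayCone_iff.1 hh
  refine mem_rayCone_iff.2 ⟨{x | x ∈ T ∧ x ∈ U ∧ (a • g + b • h : Lp ℝ 2 ν) x = a * g x + b * h x},
    ?_, ?_⟩
  · filter_upwards [hT, hU, Lp.coeFn_add (a • g) (b • h), Lp.coeFn_smul a g, Lp.coeFn_smul b h]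
      with x h1 h2 h3 h4 h5
    refine ⟨h1, h2, ?_⟩
    rw [h3, Pi.add_apply, h4, h5]
    rfl
  · rintro x ⟨hx1, hx2, hx3⟩ y ⟨hy1, hy2, hy3⟩ hxy
    rw [hx3, hy3]
    have h1 := hgT hx1 hy1 hxy
    have h2 := hhU hx2 hy2 hxy
    gcongr

/-- An `L²` limit is an a.e. limit along a subsequence, and monotonicity survives pointwise limits.
-/
lemma isClosed_rayCone (ν : Measure ℝ) : IsClosed (rayCone ν) := by
  refine IsSeqClosed.isClosed fun u g hu hug => ?_
  obtain ⟨ns, -, hns⟩ := (tendstoInMeasure_of_tendsto_Lp hug).exists_seq_tendsto_ae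
  choose T hT huT using fun n => mem_rayCone_iff.1 (hu n)
  refine mem_rayCone_iff.2
    ⟨{x | (∀ n, x ∈ T n) ∧ Tendsto (fun i => u (ns i) x) atTop (𝓝 (g x))}, ?_, ?_⟩
  · filter_upwards [ae_all_iff.2 hT, hns] with x h1 h2
    exact ⟨h1, h2⟩
  · rintro x ⟨hx1, hx2⟩ y ⟨hy1, hy2⟩ hxy
    exact le_of_tendsto_of_tendsto' hy2 hx2 fun i => huT _ (hx1 _) (hy1 _) hxy

lemma const_mem_rayCone (ν : Measure ℝ) [IsFiniteMeasure ν] (c : ℝ) :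
    Lp.const 2 ν c ∈ rayCone ν := by
  refine mem_rayCone_iff.2 ⟨{x | Lp.const 2 ν c x = c}, Lp.coeFn_const .., ?_⟩
  intro x hx y hy _
  exact (hy.trans hx.symm).le

/-! ### Projection onto the cone and its values at atoms -/

lemma metricProj_spec {E : Type*} [NormedAddCommGroup E] [InnerProductSpace ℝ E] [CompleteSpace E]
    {M : Set E} (hne : M.Nonempty) (hc : IsClosed M) (hconv : Convex ℝ M) (g : E) :
    metricProj M g ∈ M ∧ ∀ h ∈ M, ‖g - metricProj M g‖ ≤ ‖g - h‖ := by
  refine Classical.epsilon_spec (p := fun p : E => p ∈ M ∧ ∀ h ∈ M, ‖g - p‖ ≤ ‖g - h‖) ?_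
  obtain ⟨v, hv, hv'⟩ := exists_norm_eq_iInf_of_complete_convex hne hc.isComplete hconv g
  refine ⟨v, hv, fun h hh => ?_⟩
  rw [hv']
  exact ciInf_le ⟨0, Set.forall_mem_range.2 fun _ => norm_nonneg _⟩ (⟨h, hh⟩ : M)

/-- The constant competes with the nearest point, and the triangle inequality costs the factor 2.
Nonexpansiveness of the projection is not needed. -/
lemma norm_metricProj_rayCone_sub_const_le (ν : Measure ℝ) [IsFiniteMeasure ν] (g : Lp ℝ 2 ν)
    (c : ℝ) : ‖metricProj (rayCone ν) g - Lp.const 2 ν c‖ ≤ 2 * ‖g - Lp.const 2 ν c‖ := by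
  have h := (metricProj_spec ⟨_, const_mem_rayCone ν c⟩ (isClosed_rayCone ν)
    (convex_rayCone ν) g).2 _ (const_mem_rayCone ν c)
  have h' := norm_sub_le_norm_sub_add_norm_sub (metricProj (rayCone ν) g) g (Lp.const 2 ν c)
  rw [norm_sub_rev] at h
  rw [norm_sub_rev _ g, norm_sub_rev g] at h'
  linarith

/-- Turns norm bounds into pointwise bounds at atoms. -/
lemma measureReal_singleton_mul_sq_le (μ : Measure ℝ) (g : Lp ℝ 2 μ) (s : ℝ) :
    μ.real {s} * g s ^ 2 ≤ ‖g‖ ^ 2 := by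
  have hint : Integrable (fun x => g x ^ 2) μ := (Lp.memLp g).integrable_sq
  have h1 : ‖g‖ ^ 2 = ∫ x, g x ^ 2 ∂μ := by
    rw [← real_inner_self_eq_norm_sq, L2.inner_def]
    simp [pow_two]
  have h2 := setIntegral_le_integral (s := {s}) hint (Eventually.of_forall fun x => sq_nonneg (g x))
  rwa [integral_singleton, smul_eq_mul, ← h1] at h2

lemma rnDeriv_mul_singleton {μ ν : Measure ℝ} [IsFiniteMeasure μ] [IsFiniteMeasure ν]
    (h : μ ≪ ν) (s : ℝ) : (μ.rnDeriv ν s).toReal * ν.real {s} = μ.real {s} := by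
  have := Measure.setLIntegral_rnDeriv h {s}
  rw [lintegral_singleton] at this
  rw [measureReal_def, measureReal_def, ← this, ENNReal.toReal_mul]

/-- If the density is within `δ` of `1` almost everywhere, so is its projection, in the weighted
sense given by the mass of the points. -/
lemma measureReal_singleton_mul_sq_proj_le {μ ν : Measure ℝ} [IsProbabilityMeasure ν] {δ : ℝ}
    (hδ : 0 ≤ δ) (h : ∀ᵐ x ∂ν, |(μ.rnDeriv ν x).toReal - 1| ≤ δ) {s : ℝ} (hs : ν {s} ≠ 0) :
    ν.real {s} * (metricProj (rayCone ν) (densityL2 μ ν) s - 1) ^ 2 ≤ (2 * δ) ^ 2 := by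
  have hmem : MemLp (fun x => (μ.rnDeriv ν x).toReal) 2 ν := by
    refine MemLp.of_bound (Measure.measurable_rnDeriv μ ν).ennreal_toReal.aestronglyMeasurable
      (1 + δ) ?_
    filter_upwards [h] with x hx
    rw [Real.norm_eq_abs, abs_le]
    rw [abs_le] at hx
    constructor <;> linarith [hx.1, hx.2]
  have hg : ‖densityL2 μ ν - Lp.const 2 ν 1‖ ≤ δ := by
    have hb : ∀ᵐ x ∂ν, ‖(densityL2 μ ν - Lp.const 2 ν 1 : Lp ℝ 2 ν) x‖ ≤ δ := by
      rw [densityL2, dif_pos hmem]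
      filter_upwards [h, Lp.coeFn_sub (hmem.toLp _) (Lp.const 2 ν 1), hmem.coeFn_toLp,
        Lp.coeFn_const (p := 2) (μ := ν) (1 : ℝ)] with x h1 h2 h3 h4
      rw [h2, Pi.sub_apply, h3, h4]
      exact h1
    simpa [measureUnivNNReal] using Lp.norm_le_of_ae_bound hδ hb
  have hproj := norm_metricProj_rayCone_sub_const_le ν (densityL2 μ ν) 1
  have hsq := measureReal_singleton_mul_sq_le ν
    (metricProj (rayCone ν) (densityL2 μ ν) - Lp.const 2 ν 1) s
  have hval : (metricProj (rayCone ν) (densityL2 μ ν) - Lp.const 2 ν 1 : Lp ℝ 2 ν) s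
      = metricProj (rayCone ν) (densityL2 μ ν) s - 1 := by
    have hae : ∀ᵐ x ∂ν, (metricProj (rayCone ν) (densityL2 μ ν) - Lp.const 2 ν 1 : Lp ℝ 2 ν) x
        = metricProj (rayCone ν) (densityL2 μ ν) x - 1 := by
      filter_upwards [Lp.coeFn_sub (metricProj (rayCone ν) (densityL2 μ ν)) (Lp.const 2 ν 1),
        Lp.coeFn_const (p := 2) (μ := ν) (1 : ℝ)] with x h1 h2
      rw [h1, Pi.sub_apply, h2]
      rfl
    -- An a.e. identity holds at every point of positive mass.
    by_contra hne
    exact hs (measure_mono_null (Set.singleton_subset_iff.2 hne) (ae_iff.1 hae))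
  rw [hval] at hsq
  refine hsq.trans (pow_le_pow_left₀ (norm_nonneg _) ?_ 2)
  linarith

lemma IsDivergenceFunction.continuousAt_one {f : ℝ → ℝ} (hf : IsDivergenceFunction f) :
    ContinuousAt f 1 :=
  hf.convex.continuousOn_interior.continuousAt (by
    rw [interior_Ici]
    exact isOpen_Ioi.mem_nhds (by norm_num))

lemma absolutelyContinuous_of_finset {μ ν : Measure ℝ} {S : Finset ℝ} (hS : μ (S : Set ℝ)ᶜ = 0)
    (h : ∀ s ∈ S, ν {s} ≠ 0) : μ ≪ ν := by
  intro A hA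
  have hdisj : A ⊆ (S : Set ℝ)ᶜ := fun x hx hxS =>
    h x hxS (measure_mono_null (Set.singleton_subset_iff.2 hx) hA)
  exact measure_mono_null hdisj hS

/-- Deterministic form of the theorem: if the masses of the atoms of a finitely supported `ν`
converge, then so does the divergence. -/
lemma tendsto_rayDiv_of_tendsto_singleton {f : ℝ → ℝ} (hf : IsDivergenceFunction f)
    {ν : Measure ℝ} [IsProbabilityMeasure ν] {S : Finset ℝ} (hS : ν (S : Set ℝ)ᶜ = 0)
    (hpos : ∀ s ∈ S, ν {s} ≠ 0) {μ : ℕ → Measure ℝ} (hprob : ∀ᶠ n in atTop, IsProbabilityMeasure (μ n))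
    (hμS : ∀ n, μ n (S : Set ℝ)ᶜ = 0)
    (hlim : ∀ s ∈ S, Tendsto (fun n => (μ n).real {s}) atTop (𝓝 (ν.real {s}))) :
    (∀ᶠ n in atTop, ν ≪ μ n) ∧ Tendsto (fun n => rayDiv f ν (μ n)) atTop (𝓝 0) := by
  have hpos' : ∀ s ∈ S, 0 < ν.real {s} := fun s hs =>
    ENNReal.toReal_pos (hpos s hs) (measure_ne_top _ _)
  have hhalf : ∀ᶠ n in atTop, ∀ s ∈ S, ν.real {s} / 2 < (μ n).real {s} :=
    (Filter.eventually_all_finset S).2 fun s hs =>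
      (hlim s hs).eventually_const_lt (half_lt_self (hpos' s hs))
  have hne : ∀ᶠ n in atTop, ∀ s ∈ S, μ n {s} ≠ 0 := by
    filter_upwards [hhalf] with n hn s hs h0
    have := hn s hs
    rw [measureReal_def, measureReal_def, h0, ENNReal.toReal_zero, ← measureReal_def] at this
    linarith [hpos' s hs]
  have hac : ∀ᶠ n in atTop, ν ≪ μ n := by
    filter_upwards [hne] with n hn
    exact absolutelyContinuous_of_finset hS hn
  refine ⟨hac, Metric.tendsto_nhds.2 fun ε hε => ?_⟩
  obtain ⟨η, hη, hfη⟩ := Metric.continuousAt_iff.1 hf.continuousAt_one (ε / 2) (half_pos hε)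
  -- Since eventually `μ n` gives `s` more than half of `ν.real {s}`, this `δ` forces the projection
  -- to be within `η` of 1 at `s`.
  obtain ⟨δ, hδS, hδ⟩ : ∃ δ : ℝ, (∀ s ∈ S, (2 * δ) ^ 2 < ν.real {s} / 2 * η ^ 2) ∧ 0 < δ := by
    have hsmall : ∀ᶠ δ in 𝓝[>] (0 : ℝ), ∀ s ∈ S, (2 * δ) ^ 2 < ν.real {s} / 2 * η ^ 2 := by
      refine (Filter.eventually_all_finset S).2 fun s hs => ?_
      have hc : Tendsto (fun δ : ℝ => (2 * δ) ^ 2) (𝓝[>] 0) (𝓝 ((2 * 0) ^ 2)) :=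
        (Continuous.tendsto (by fun_prop) 0).mono_left nhdsWithin_le_nhds
      refine hc.eventually_lt_const ?_
      have := hpos' s hs
      rw [mul_zero, zero_pow two_ne_zero]
      positivity
    exact (hsmall.and self_mem_nhdsWithin).exists
  have hdens : ∀ᶠ n in atTop, ∀ s ∈ S, |ν.real {s} / (μ n).real {s} - 1| < δ := by
    refine (Filter.eventually_all_finset S).2 fun s hs => ?_
    have h := (tendsto_const_nhds (x := ν.real {s})).div (hlim s hs) (hpos' s hs).ne'
    rw [div_self (hpos' s hs).ne'] at h
    exact Metric.tendsto_nhds.1 h δ hδ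
  filter_upwards [hhalf, hne, hac, hdens, hprob] with n h1 h2 h3 h4 h5
  have hmemS : ∀ᵐ x ∂(μ n), x ∈ S := hμS n
  have hbound : ∀ᵐ x ∂(μ n), |(ν.rnDeriv (μ n) x).toReal - 1| ≤ δ := by
    filter_upwards [hmemS] with s hs
    have h0 : (μ n).real {s} ≠ 0 := by linarith [h1 s hs, hpos' s hs]
    rw [eq_div_of_mul_eq h0 (rnDeriv_mul_singleton h3 s)]
    exact (h4 s hs).le
  have hint : ∀ᵐ x ∂(μ n), ‖f (metricProj (rayCone (μ n)) (densityL2 ν (μ n)) x)‖ ≤ ε / 2 := by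
    filter_upwards [hmemS] with s hs
    have hle := measureReal_singleton_mul_sq_proj_le hδ.le hbound (h2 s hs)
    set p := metricProj (rayCone (μ n)) (densityL2 ν (μ n)) s
    have hlt : (μ n).real {s} * (p - 1) ^ 2 < (μ n).real {s} * η ^ 2 :=
      (hle.trans_lt (hδS s hs)).trans_le
        (mul_le_mul_of_nonneg_right (h1 s hs).le (sq_nonneg η))
    have hp : |p - 1| < η := abs_lt_of_sq_lt_sq (lt_of_mul_lt_mul_left hlt measureReal_nonneg) hη.le
    have := hfη (x := p) hp
    rw [hf.map_one, dist_zero_right] at this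
    exact this.le
  have hfin := norm_integral_le_of_norm_le_const hint
  rw [probReal_univ, mul_one] at hfin
  rw [dist_zero_right]
  exact hfin.trans_lt (half_lt_self hε)

/-! ### Empirical measures and the law of large numbers -/

section Empirical

variable {Ω : Type*} (X : ℕ → Ω → ℝ)

lemma empiricalMeasure_apply (n : ℕ) (ω : Ω) {A : Set ℝ} (hA : MeasurableSet A) :
    empiricalMeasure X n ω A
      = (n : ℝ≥0∞)⁻¹ * ∑ i ∈ Finset.range n, A.indicator 1 (X i ω) := by
  simp [empiricalMeasure, Measure.finsetSum_apply, Measure.dirac_apply' _ hA]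

lemma empiricalMeasure_real_apply (n : ℕ) (ω : Ω) {A : Set ℝ} (hA : MeasurableSet A) :
    (empiricalMeasure X n ω).real A
      = (∑ i ∈ Finset.range n, A.indicator (1 : ℝ → ℝ) (X i ω)) / n := by
  rw [measureReal_def, empiricalMeasure_apply X n ω hA, ENNReal.toReal_mul,
    ENNReal.toReal_sum fun i _ => by by_cases h : X i ω ∈ A <;> simp [h]]
  rw [ENNReal.toReal_inv, ENNReal.toReal_natCast, div_eq_inv_mul]
  congr 1
  refine Finset.sum_congr rfl fun i _ => ?_
  by_cases h : X i ω ∈ A <;> simp [h]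

lemma isProbabilityMeasure_empiricalMeasure {n : ℕ} (hn : n ≠ 0) (ω : Ω) :
    IsProbabilityMeasure (empiricalMeasure X n ω) := by
  refine ⟨?_⟩
  rw [empiricalMeasure_apply X n ω MeasurableSet.univ]
  simpa using ENNReal.inv_mul_cancel (by exact_mod_cast hn) (ENNReal.natCast_ne_top n)

lemma empiricalMeasure_compl_eq_zero (n : ℕ) (ω : Ω) {S : Set ℝ} (hS : MeasurableSet S)
    (h : ∀ i < n, X i ω ∈ S) : empiricalMeasure X n ω Sᶜ = 0 := by
  rw [empiricalMeasure_apply X n ω hS.compl, Finset.sum_eq_zero, mul_zero]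
  intro i hi
  simp [h i (Finset.mem_range.1 hi)]

/-- The strong law of large numbers for the empirical measure of a fixed set. -/
lemma ae_tendsto_empiricalMeasure_real {X : ℕ → Ω → ℝ} [MeasurableSpace Ω] {P : Measure Ω}
    [IsProbabilityMeasure P] {ν : Measure ℝ} (hlaw : ∀ i, HasLaw (X i) ν P)
    (hindep : iIndepFun X P) {A : Set ℝ} (hA : MeasurableSet A) :
    ∀ᵐ ω ∂P, Tendsto (fun n => (empiricalMeasure X n ω).real A) atTop (𝓝 (ν.real A)) := by
  have hmeas : Measurable (A.indicator (1 : ℝ → ℝ)) := measurable_one.indicator hA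
  have hX : ∀ i, AEMeasurable (fun ω => A.indicator (1 : ℝ → ℝ) (X i ω)) P := fun i =>
    hmeas.comp_aemeasurable (hlaw i).aemeasurable
  have hslln := strong_law_ae_real (μ := P) (fun i ω => A.indicator (1 : ℝ → ℝ) (X i ω))
    (Integrable.of_bound (hX 0).aestronglyMeasurable 1 (Eventually.of_forall fun ω => by
      by_cases h : X 0 ω ∈ A <;> simp [h]))
    (fun i j hij => (hindep.indepFun hij).comp hmeas hmeas)
    (fun i => ((hlaw i).identDistrib (hlaw 0)).comp hmeas)
  have hmean : ∫ ω, A.indicator (1 : ℝ → ℝ) (X 0 ω) ∂P = ν.real A := by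
    have := (hlaw 0).integral_comp (f := A.indicator (1 : ℝ → ℝ)) hmeas.aestronglyMeasurable
    rw [integral_indicator_one hA] at this
    exact this
  filter_upwards [hslln] with ω hω
  rw [hmean] at hω
  simpa only [empiricalMeasure_real_apply X _ ω hA] using hω

end Empirical

/-- A finitely supported measure is carried by the finite set of its atoms. -/
lemma exists_finset_atoms {ν : Measure ℝ} (h : ∃ S : Set ℝ, S.Finite ∧ ν Sᶜ = 0) :
    ∃ S : Finset ℝ, ν (S : Set ℝ)ᶜ = 0 ∧ ∀ s ∈ S, ν {s} ≠ 0 := by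
  classical
  obtain ⟨S, hS, hνS⟩ := h
  refine ⟨hS.toFinset.filter fun s => ν {s} ≠ 0, ?_, fun s hs => (Finset.mem_filter.1 hs).2⟩
  have hnull : ν (⋃ s ∈ S ∩ {s | ν {s} = 0}, {s}) = 0 :=
    (measure_biUnion_null_iff (hS.inter_of_left _).countable).2 fun s hs => hs.2
  refine measure_mono_null (fun x hx => ?_) (measure_union_null hνS hnull)
  by_cases hxS : x ∈ S
  · right
    simpa [hxS] using hx
  · exact Or.inl hxS

end RayDivergence

/-- Glivenko--Cantelli theorem for `f`-divergences over rays, reversed arguments. The divergence of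
`ν` from the empirical measure `ν_n` is defined when `ν ≪ ν_n`, and the limit is taken along these
`n`. If `ν` is supported by a finite set then these are almost surely all large `n`, so that the
limit is an ordinary one. -/
theorem theorem5p4 {Ω : Type*} [MeasurableSpace Ω] (P : Measure Ω) [IsProbabilityMeasure P]
    (ν : Measure ℝ) [IsProbabilityMeasure ν] (X : ℕ → Ω → ℝ)
    (hlaw : ∀ i, HasLaw (X i) ν P) (hindep : iIndepFun X P)
    (f : ℝ → ℝ) (hf : RayDivergence.IsDivergenceFunction f) :
    ∀ᵐ ω ∂P,
      Tendsto (fun n : ℕ => RayDivergence.rayDiv f ν (RayDivergence.empiricalMeasure X n ω))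
        (atTop ⊓ 𝓟 {n : ℕ | ν ≪ RayDivergence.empiricalMeasure X n ω}) (𝓝 0) ∧
      ((∃ S : Set ℝ, S.Finite ∧ ν Sᶜ = 0) →
        (∀ᶠ n : ℕ in atTop, ν ≪ RayDivergence.empiricalMeasure X n ω) ∧
        Tendsto (fun n : ℕ => RayDivergence.rayDiv f ν (RayDivergence.empiricalMeasure X n ω))
          atTop (𝓝 0)) := by
  by_cases hfin : ∃ S : Set ℝ, S.Finite ∧ ν Sᶜ = 0
  · obtain ⟨S, hS, hpos⟩ := RayDivergence.exists_finset_atoms hfin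
    have hmem : ∀ᵐ ω ∂P, ∀ i, X i ω ∈ (S : Set ℝ) := ae_all_iff.2 fun i =>
      ((hlaw i).ae_iff S.measurableSet.mem).2 hS
    have hlim : ∀ᵐ ω ∂P, ∀ s ∈ S, Tendsto
        (fun n => (RayDivergence.empiricalMeasure X n ω).real {s}) atTop (𝓝 (ν.real {s})) :=
      (Filter.eventually_all_finset S).2 fun s _ =>
        RayDivergence.ae_tendsto_empiricalMeasure_real hlaw hindep (measurableSet_singleton s)
    filter_upwards [hmem, hlim] with ω h1 h2
    have hmain := RayDivergence.tendsto_rayDiv_of_tendsto_singleton hf hS hpos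
      -- For `n = 0` the empirical measure is zero, hence not a probability measure.
      ((eventually_ne_atTop 0).mono fun n hn =>
        RayDivergence.isProbabilityMeasure_empiricalMeasure X hn ω)
      (fun n => RayDivergence.empiricalMeasure_compl_eq_zero X n ω S.measurableSet fun i _ => h1 i)
      h2
    exact ⟨hmain.2.mono_left inf_le_left, fun _ => hmain⟩
  · refine Eventually.of_forall fun ω => ⟨?_, fun h => absurd h hfin⟩
    have hempty : {n : ℕ | ν ≪ RayDivergence.empiricalMeasure X n ω} = ∅ := by
      refine Set.eq_empty_of_forall_notMem fun n hn => hfin ?_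
      have hT : ((fun i => X i ω) '' Set.Iio n).Finite := (Set.finite_Iio n).image _
      exact ⟨_, hT, hn (RayDivergence.empiricalMeasure_compl_eq_zero X n ω hT.measurableSet
        fun i hi => ⟨i, hi, rfl⟩)⟩
    -- No index is admissible, so the limit is along the trivial filter.
    rw [hempty, principal_empty, inf_bot_eq]
    exact tendsto_bot
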